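/- Let $q$ be a prime power, $\mathbb{F}_q$ the finite field with $q$ elements, and let $\mathrm{Int}(\mathbb{F}_q[t]) = \{f \in \mathbb{F}_q(t)[X] \mid f(\mathbb{F}_q[t]) \subseteq \mathbb{F}_q[t]\}$ be the ring of integer-valued polynomials on $\mathbb{F}_q[t]$. For $m \ge 0$ put $$\psi_m(X) = \prod_{f \in \mathbb{F}_q[t],\ \deg f < m} (X - f), \qquad F_m = \prod_{j=1}^{m} \bigl(t^{q^j} - t\bigr)^{q^{m-j}},$$ where $\deg 0 = -\infty$, so that $\psi_0 = X$ and $F_0 = 1$. For a non-negative integer $k = \alpha_0 + \alpha_1 q + \dots + \alpha_s q^s$ with base-$q$ digits $\alpha_i \in \{0,\dots,q-1\}$, the $k$-th Carlitz binomial polynomial is $$\beta_k(X) = \frac{\psi_0(X)^{\alpha_0} \cdots \psi_s(X)^{\alpha_s}}{F_0^{\alpha_0} \cdots F_s^{\alpha_s}} \in \mathbb{F}_q(t)[X].$$ Then $\beta_k \in \mathrm{Int}(\mathbb{F}_q[t])$ for all $k \ge 0$, and the following hold. (1) For every positive integer $k$, the polynomial $\beta_k$ is irreducible in $\mathrm{Int}(\mathbb{F}_q[t])$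 if and only if $k = q^s$ for some integer $s \ge 0$. More precisely, writing $k = \alpha_0 + \alpha_1 q + \dots + \alpha_s q^s$ with $s \ge 0$, $\alpha_i \in \{0,\dots,q-1\}$ and $\alpha_s \ne 0$, one has $$\beta_k = \prod_{i=0}^{s} (\beta_{q^i})^{\alpha_i}.$$ (2) For every integer $s \ge 0$, the polynomial $\beta_{q^s}$ is absolutely irreducible in $\mathrm{Int}(\mathbb{F}_q[t])$; that is, it is irreducible and for every integer $m \ge 1$ the power $\beta_{q^s}^m$ factors uniquely as a product of irreducible elements of $\mathrm{Int}(\mathbb{F}_q[t])$, up to the order of the factors and multiplication by units. -/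

import Mathlib

open Polynomial

noncomputable section

/-- The ring `Int(D) = {f ∈ K[X] | f(D) ⊆ D}` of integer-valued polynomials on `D`,
where `K` is an overfield of `D`. -/
def integerValuedPolynomials (D K : Type*) [CommRing D] [Field K] [Algebra D K] :
    Subring K[X] where
  carrier := {f | ∀ a : D, f.eval (algebraMap D K a) ∈ (algebraMap D K).range}
  mul_mem' := fun hf hg a => by
    rw [eval_mul]
    exact Subring.mul_mem _ (hf a) (hg a)
  one_mem' := fun a => by
    rw [eval_one]
    exact Subring.one_mem _
  add_mem' := fun hf hg a => by
    rw [eval_add]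
    exact Subring.add_mem _ (hf a) (hg a)
  zero_mem' := fun a => by
    rw [eval_zero]
    exact Subring.zero_mem _
  neg_mem' := fun hf a => by
    rw [eval_neg]
    exact Subring.neg_mem _ (hf a)

/-- `a` is a product of irreducible elements, in a unique way up to the order of the factors and
associatedness. -/
def FactorsUniquely {R : Type*} [CommMonoid R] (a : R) : Prop :=
  (∃ u : Multiset R, (∀ b ∈ u, Irreducible b) ∧ u.prod = a) ∧
    ∀ u v : Multiset R, (∀ b ∈ u, Irreducible b) → (∀ b ∈ v, Irreducible b) →
      u.prod = a → v.prod = a → Multiset.Rel Associated u v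

/-- `a` is irreducible and all its powers with positive exponent factor uniquely into
irreducible elements. -/
def AbsolutelyIrreducible {R : Type*} [CommMonoid R] (a : R) : Prop :=
  Irreducible a ∧ ∀ m : ℕ, 0 < m → FactorsUniquely (a ^ m)

theorem finite_setOf_degree_lt (F : Type*) [Field F] [Fintype F] (m : ℕ) :
    {f : F[X] | f.degree < m}.Finite := by
  have h : Finite (degreeLT F m) := Finite.of_equiv _ (degreeLTEquiv F m).symm.toEquiv
  have h2 : {f : F[X] | f.degree < m} = (degreeLT F m : Set F[X]) := by
    ext f
    simp [mem_degreeLT]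
  rw [h2]
  exact Set.toFinite _

/-- `ψ_m(X) = ∏ (X - f)`, the product over all `f ∈ 𝔽_q[t]` with `deg f < m`. -/
def carlitzPsi (F : Type*) [Field F] [Fintype F] (m : ℕ) : (RatFunc F)[X] :=
  ∏ f ∈ (finite_setOf_degree_lt F m).toFinset, (X - C (algebraMap F[X] (RatFunc F) f))

/-- `F_m = (t^(q^m) - t) (t^(q^(m-1)) - t)^q ⋯ (t^q - t)^(q^(m-1)) ∈ 𝔽_q[t]`, with `F_0 = 1`.
Here the polynomial variable `X` plays the role of `t`. -/
def carlitzF (F : Type*) [Field F] [Fintype F] (m : ℕ) : F[X] :=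
  ∏ j ∈ Finset.Icc 1 m, (X ^ (Fintype.card F ^ j) - X) ^ (Fintype.card F ^ (m - j))

/-- `G_k = ∏ ψ_i ^ α_i`, where the `α_i` are the base-`q` digits of `k`. -/
def carlitzG (F : Type*) [Field F] [Fintype F] (k : ℕ) : (RatFunc F)[X] :=
  ∏ i ∈ Finset.range (Nat.digits (Fintype.card F) k).length,
    carlitzPsi F i ^ (Nat.digits (Fintype.card F) k).getD i 0

/-- `g_k = ∏ F_i ^ α_i`, where the `α_i` are the base-`q` digits of `k`. -/
def carlitzg (F : Type*) [Field F] [Fintype F] (k : ℕ) : F[X] :=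
  ∏ i ∈ Finset.range (Nat.digits (Fintype.card F) k).length,
    carlitzF F i ^ (Nat.digits (Fintype.card F) k).getD i 0

/-- The `k`-th Carlitz binomial polynomial `β_k = G_k / g_k ∈ 𝔽_q(t)[X]`. -/
def carlitzBinomial (F : Type*) [Field F] [Fintype F] (k : ℕ) : (RatFunc F)[X] :=
  C (algebraMap F[X] (RatFunc F) (carlitzg F k))⁻¹ * carlitzG F k

end

/-!
Let `E = ψ_s / F_s`. Carlitz's recursion `ψ_(s+1) = ψ_s ^ q - F_s ^ (q - 1) ψ_s` shows that `ψ_s`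
is additive and that `F_s` divides every value of `ψ_s` on `𝔽_q[t]`, so `E` is integer-valued, and
that `E` takes the value `1` at all monic polynomials of degree `s`. If `g` divides a power of `E`
in `Int(𝔽_q[t])`, then `g` is a constant times `∏ (X - f) ^ e_f` over `deg f < s`, and its values
at monic polynomials of degree `s` are units. Evaluating at `P + f`, where `P` is monic irreducible
of degree `s`, the valuation at `P` of the product is exactly `e_f`; hence all `e_f` agree and `g`
is a unit times a power of `E`. As `β_k` is the product of the `β_(q^i)` prescribed by the digits of
`k` and has degree `k`, it is irreducible only if it is associated to a single one of them.
-/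

section Factorization

theorem irreducible_of_dvd_imp_associated_pow {R : Type*} [CommMonoidWithZero R]
    [IsCancelMulZero R] {a : R} (h0 : a ≠ 0) (hu : ¬IsUnit a)
    (h : ∀ b : R, b ∣ a → ∃ j : ℕ, Associated b (a ^ j)) : Irreducible a := by
  refine ⟨hu, fun b c hbc => ?_⟩
  obtain ⟨j, hj⟩ := h b ⟨c, hbc⟩
  rcases eq_or_ne j 0 with rfl | hj0
  · exact Or.inl (associated_one_iff_isUnit.mp (by simpa using hj))
  · obtain ⟨d, rfl⟩ : a ∣ b := (dvd_pow_self a hj0).trans hj.symm.dvd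
    have hdc : IsUnit (d * c) := by
      refine isUnit_of_associated_mul (p := a) (.of_eq ?_) h0
      rw [← mul_assoc, ← hbc]
    exact Or.inr (isUnit_of_mul_isUnit_right hdc)

theorem factorsUniquely_pow_of_irreducible {R : Type*} [CommMonoidWithZero R]
    [IsCancelMulZero R] {a : R} (ha : Irreducible a) {m : ℕ}
    (h : ∀ b : R, Irreducible b → b ∣ a ^ m → Associated b a) : FactorsUniquely (a ^ m) := by
  have rel_replicate : ∀ u : Multiset R, (∀ b ∈ u, Irreducible b) → u.prod = a ^ m →
      Multiset.Rel Associated u (Multiset.replicate m a) := by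
    intro u hu hprod
    have hassoc : ∀ b ∈ u, Associated b a := fun b hb =>
      h b (hu b hb) (hprod ▸ Multiset.dvd_prod hb)
    have hrel : Multiset.Rel Associated u (Multiset.replicate (Multiset.card u) a) :=
      Multiset.rel_replicate_right.mpr ⟨rfl, hassoc⟩
    have hpow : Associated (a ^ m) (a ^ Multiset.card u) := by
      rw [← hprod, ← Multiset.prod_replicate, ← Associates.mk_eq_mk_iff_associated,
        ← Associates.prod_mk, ← Associates.prod_mk,
        Associates.rel_associated_iff_map_eq_map.mp hrel]
    have hcard : Multiset.card u = m := le_antisymm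
      ((pow_dvd_pow_iff ha.ne_zero ha.not_isUnit).mp hpow.symm.dvd)
      ((pow_dvd_pow_iff ha.ne_zero ha.not_isUnit).mp hpow.dvd)
    exact Multiset.rel_replicate_right.mpr ⟨hcard, hassoc⟩
  refine ⟨⟨Multiset.replicate m a, fun b hb => ?_, Multiset.prod_replicate m a⟩,
    fun u v hu hv hup hvp => ?_⟩
  · rwa [Multiset.eq_of_mem_replicate hb]
  · exact (rel_replicate u hu hup).trans _
      (Multiset.rel_flip.mp <| (rel_replicate v hv hvp).mono fun _ _ _ _ hab => hab.symm)

theorem absolutelyIrreducible_of_dvd_pow {R : Type*} [CommMonoidWithZero R]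
    [IsCancelMulZero R] {a : R} (h0 : a ≠ 0) (hu : ¬IsUnit a)
    (h : ∀ (m : ℕ) (b : R), b ∣ a ^ m → ∃ j : ℕ, Associated b (a ^ j)) :
    AbsolutelyIrreducible a := by
  have hirr : Irreducible a :=
    irreducible_of_dvd_imp_associated_pow h0 hu fun b hb => h 1 b (by rwa [pow_one])
  refine ⟨hirr, fun m _ => factorsUniquely_pow_of_irreducible hirr fun b hb hdvd => ?_⟩
  obtain ⟨j, hj⟩ := h m b hdvd
  obtain rfl : j = 1 := by
    by_contra hne
    exact not_irreducible_pow hne (hj.irreducible hb)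
  rwa [pow_one] at hj

theorem exists_eq_mul_prod_pow_of_dvd_mul_prod_pow {R ι : Type*} [CommMonoidWithZero R]
    [IsCancelMulZero R] {p : ι → R} {s : Finset ι} (hp : ∀ i ∈ s, Prime (p i)) {n : ι → ℕ}
    {a x : R} (hx : x ∣ a * ∏ i ∈ s, p i ^ n i) :
    ∃ (b : R) (e : ι → ℕ), b ∣ a ∧ x = b * ∏ i ∈ s, p i ^ e i := by
  classical
  induction s using Finset.induction_on generalizing a with
  | empty => exact ⟨x, 0, by simpa using hx, by simp⟩
  | insert j s hj ih =>
    rw [Finset.prod_insert hj, ← mul_assoc] at hx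
    obtain ⟨b, e, ⟨c, hbc⟩, rfl⟩ := ih (fun i hi => hp i (Finset.mem_insert_of_mem hi)) hx
    obtain ⟨k, -, b', c', -, rfl, rfl, -⟩ :=
      mul_eq_mul_prime_pow (hp j (Finset.mem_insert_self j s)) hbc.symm
    refine ⟨b', Function.update e j k, Dvd.intro c' rfl, ?_⟩
    have hcongr : ∏ i ∈ s, p i ^ Function.update e j k i = ∏ i ∈ s, p i ^ e i :=
      Finset.prod_congr rfl fun i hi => by
        rw [Function.update_of_ne (ne_of_mem_of_not_mem hi hj)]
    rw [Finset.prod_insert hj, Function.update_self, hcongr, mul_assoc]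

theorem emultiplicity_prod_add_sub_pow {D : Type*} [CommRing D] [IsDomain D] {P : D}
    (hP : Prime P) {S : Finset D} {r : D} (hr : r ∈ S) (hS : ∀ r' ∈ S, P ∣ r - r' → r = r')
    (e : D → ℕ) : emultiplicity P (∏ r' ∈ S, (P + r - r') ^ e r') = e r := by
  rw [Finset.emultiplicity_prod hP, Finset.sum_eq_single_of_mem r hr, add_sub_cancel_right,
    emultiplicity_pow_self_of_prime hP]
  intro r' hr' hne
  rw [emultiplicity_eq_zero]
  intro hdvd
  have hdvd' := hP.dvd_of_dvd_pow hdvd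
  rw [add_sub_assoc, dvd_add_right dvd_rfl] at hdvd'
  exact hne (hS r' hr' hdvd').symm

end Factorization

namespace integerValuedPolynomials

variable {D K : Type*} [CommRing D] [Field K] [Algebra D K]

/-- The embedding of `D` into `Int(D)` as the constant polynomials; it carries units of `D` to units
of `Int(D)`. -/
noncomputable def const : D →+* integerValuedPolynomials D K :=
  (C.comp (algebraMap D K)).codRestrict _ fun b a => ⟨b, by simp⟩

theorem natDegree_eq_of_associated {f g : integerValuedPolynomials D K} (h : Associated f g) :
    (f : K[X]).natDegree = (g : K[X]).natDegree :=
  Polynomial.natDegree_eq_of_degree_eq <|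
    degree_eq_degree_of_associated (h.map (integerValuedPolynomials D K).subtype)

theorem exists_eq_C_mul_prod_of_dvd_pow {f g : integerValuedPolynomials D K} {S : Finset D} {c : K}
    (hc : c ≠ 0) (hf : (f : K[X]) = C c * ∏ r ∈ S, (X - C (algebraMap D K r))) {m : ℕ}
    (hgf : g ∣ f ^ m) :
    ∃ (b : K) (e : D → ℕ), (g : K[X]) = C b * ∏ r ∈ S, (X - C (algebraMap D K r)) ^ e r := by
  have hdvd : (g : K[X]) ∣ C c ^ m * ∏ r ∈ S, (X - C (algebraMap D K r)) ^ m := by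
    rw [Finset.prod_pow, ← mul_pow, ← hf]
    exact map_dvd (integerValuedPolynomials D K).subtype hgf
  obtain ⟨x, e, hx, hg⟩ :=
    exists_eq_mul_prod_pow_of_dvd_mul_prod_pow (fun r _ => prime_X_sub_C (algebraMap D K r)) hdvd
  obtain ⟨b, -, rfl⟩ := isUnit_iff.mp (isUnit_of_dvd_unit hx ((isUnit_C.mpr hc.isUnit).pow m))
  exact ⟨b, e, hg⟩

variable [FaithfulSMul D K]

/-- Evaluation of integer-valued polynomials at `a ∈ D`, with values in `D` rather than in `K`, so
that divisibility and units of `D` can be applied to them. -/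
noncomputable def evalHom (a : D) : integerValuedPolynomials D K →+* D :=
  (AlgEquiv.ofInjective (Algebra.ofId D K)
      (FaithfulSMul.algebraMap_injective D K)).symm.toRingHom.comp <|
    (evalRingHom (algebraMap D K a)).restrict _ (Algebra.ofId D K).range fun _ hf => hf a

theorem algebraMap_evalHom (a : D) (f : integerValuedPolynomials D K) :
    algebraMap D K (evalHom a f) = (f : K[X]).eval (algebraMap D K a) :=
  congrArg Subtype.val <| (AlgEquiv.ofInjective (Algebra.ofId D K)
    (FaithfulSMul.algebraMap_injective D K)).apply_symm_apply _

theorem associated_of_eq_C_mul {f g : integerValuedPolynomials D K} {b : K}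
    (h : (g : K[X]) = C b * f) {a : D} (hf : IsUnit (evalHom a f)) (hg : IsUnit (evalHom a g)) :
    Associated g f := by
  obtain ⟨u, hu⟩ := hf
  obtain ⟨v, hv⟩ := hg
  have hb : algebraMap D K v = b * algebraMap D K u := by
    rw [hu, hv, algebraMap_evalHom, algebraMap_evalHom, h, eval_mul, eval_C]
  have hb' : b = algebraMap D K ↑(v * u⁻¹) := by
    rw [Units.val_mul, map_mul, hb, mul_assoc, ← map_mul, Units.mul_inv, map_one, mul_one]
  refine Associated.symm ⟨Units.map (const : D →+* _).toMonoidHom (v * u⁻¹), Subtype.ext ?_⟩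
  rw [h, hb', mul_comm]
  rfl

theorem associated_prod_sub_pow {g : integerValuedPolynomials D K} {S : Finset D} {b : K}
    {e : D → ℕ} (hg : (g : K[X]) = C b * ∏ r ∈ S, (X - C (algebraMap D K r)) ^ e r) {a a' : D}
    (ha : IsUnit (evalHom a g)) (ha' : IsUnit (evalHom a' g)) :
    Associated (∏ r ∈ S, (a - r) ^ e r) (∏ r ∈ S, (a' - r) ^ e r) := by
  have hinj := FaithfulSMul.algebraMap_injective D K
  have heval : ∀ x : D,
      algebraMap D K (evalHom x g) = b * algebraMap D K (∏ r ∈ S, (x - r) ^ e r) := fun x => by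
    simp [algebraMap_evalHom, hg, eval_prod]
  have hcross : (∏ r ∈ S, (a - r) ^ e r) * evalHom a' g =
      (∏ r ∈ S, (a' - r) ^ e r) * evalHom a g := by
    apply hinj
    rw [map_mul, map_mul, heval, heval]
    ring
  exact (associated_mul_unit_right _ _ ha').trans <|
    (Associated.of_eq hcross).trans (associated_mul_unit_left _ _ ha)

/-- `P` is a prime of `D` modulo which the elements of `S` are pairwise distinct, and `f` has unit
values at the points `P + r` with `r ∈ S`. Such a prime separates the roots `S` of the divisors of
the powers of `f`. -/
structure IsSeparatingPrime (f : integerValuedPolynomials D K) (S : Finset D) (P : D) : Prop where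
  prime : Prime P
  eq_of_dvd_sub : ∀ r ∈ S, ∀ r' ∈ S, P ∣ r - r' → r = r'
  isUnit_evalHom : ∀ r ∈ S, IsUnit (evalHom (P + r) f)

theorem IsSeparatingPrime.exponent_eq [IsDomain D] {f g : integerValuedPolynomials D K}
    {S : Finset D} {P : D} (hP : IsSeparatingPrime f S P) {m : ℕ} (hgf : g ∣ f ^ m) {b : K}
    {e : D → ℕ} (hg : (g : K[X]) = C b * ∏ r ∈ S, (X - C (algebraMap D K r)) ^ e r) {r r' : D}
    (hr : r ∈ S) (hr' : r' ∈ S) : e r = e r' := by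
  have hunit : ∀ x ∈ S, IsUnit (evalHom (P + x) g) := fun x hx =>
    isUnit_of_dvd_unit (map_dvd (evalHom (P + x)) hgf) <| by
      rw [map_pow]
      exact (hP.isUnit_evalHom x hx).pow m
  have hmult := emultiplicity_eq_of_associated_right (a := P) <|
    associated_prod_sub_pow hg (hunit r hr) (hunit r' hr')
  rw [emultiplicity_prod_add_sub_pow hP.prime hr (hP.eq_of_dvd_sub r hr),
    emultiplicity_prod_add_sub_pow hP.prime hr' (hP.eq_of_dvd_sub r' hr')] at hmult
  exact_mod_cast hmult

theorem absolutelyIrreducible_of_isSeparatingPrime {f : integerValuedPolynomials D K}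
    {S : Finset D} (hS : S.Nonempty) {c : K}
    (hf : (f : K[X]) = C c * ∏ r ∈ S, (X - C (algebraMap D K r)))
    {a : D} (ha : IsUnit (evalHom a f)) (hP : S.Nontrivial → ∃ P : D, IsSeparatingPrime f S P) :
    AbsolutelyIrreducible f := by
  have hinj := FaithfulSMul.algebraMap_injective D K
  have : IsDomain D := hinj.isDomain
  have hc : c ≠ 0 := by
    rintro rfl
    have hzero : evalHom a f = 0 := hinj (by rw [algebraMap_evalHom, hf]; simp)
    exact not_isUnit_zero (hzero ▸ ha)
  have hdeg : (f : K[X]).natDegree = S.card := by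
    rw [hf, natDegree_C_mul hc, natDegree_finsetProd_X_sub_C_eq_card]
  refine absolutelyIrreducible_of_dvd_pow ?_ (fun hunit => ?_) fun m g hgf => ?_
  · rintro rfl
    exact not_isUnit_zero (map_zero (evalHom (K := K) a) ▸ ha)
  · have hdeg₀ := natDegree_eq_of_associated (associated_one_iff_isUnit.mpr hunit)
    rw [hdeg, OneMemClass.coe_one, natDegree_one] at hdeg₀
    exact hS.card_ne_zero hdeg₀
  obtain ⟨b, e, hg⟩ := exists_eq_C_mul_prod_of_dvd_pow hc hf hgf
  obtain ⟨r₀, hr₀⟩ := hS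
  have hconst : ∀ r ∈ S, e r = e r₀ := fun r hr => by
    by_contra hne
    obtain ⟨P, hP⟩ := hP ⟨r, hr, r₀, hr₀, fun h => hne (h ▸ rfl)⟩
    exact hne (hP.exponent_eq hgf hg hr hr₀)
  have hg' : (g : K[X]) = C (b / c ^ e r₀) * (f ^ e r₀ : integerValuedPolynomials D K) := by
    rw [SubmonoidClass.coe_pow, hf, mul_pow, ← C_pow, ← mul_assoc, ← C_mul,
      div_mul_cancel₀ _ (pow_ne_zero _ hc), ← Finset.prod_pow, hg]
    exact congrArg _ (Finset.prod_congr rfl fun r hr => by rw [hconst r hr])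
  refine ⟨e r₀, associated_of_eq_C_mul hg' (a := a) ?_ ?_⟩
  · rw [map_pow]
    exact ha.pow _
  · exact isUnit_of_dvd_unit (map_dvd (evalHom a) hgf) (by rw [map_pow]; exact ha.pow m)

end integerValuedPolynomials

section CarlitzMap

variable (F : Type*) [Field F] [Fintype F]

theorem carlitzF_zero : carlitzF F 0 = 1 := by
  simp [carlitzF]

theorem carlitzF_succ (s : ℕ) :
    carlitzF F (s + 1) =
      (X ^ Fintype.card F ^ (s + 1) - X) * carlitzF F s ^ Fintype.card F := by
  rw [carlitzF, Finset.prod_Icc_succ_top (by lia), mul_comm, carlitzF, ← Finset.prod_pow,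
    Nat.sub_self, pow_zero, pow_one]
  refine congrArg _ (Finset.prod_congr rfl fun j hj => ?_)
  rw [← pow_mul, ← pow_succ, Nat.succ_sub (Finset.mem_Icc.mp hj).2]

theorem carlitzF_ne_zero (s : ℕ) : carlitzF F s ≠ 0 :=
  Finset.prod_ne_zero_iff.mpr fun _ hj => pow_ne_zero _ <|
    FiniteField.X_pow_card_pow_sub_X_ne_zero F
      (Nat.one_le_iff_ne_zero.mp (Finset.mem_Icc.mp hj).1) Fintype.one_lt_card

/-- The `F`-linear map `a ↦ ψ_s(a)` on `F[t]`, defined through Carlitz's recursion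
`ψ_(s+1) = ψ_s ^ q - F_s ^ (q - 1) ψ_s`, which makes linearity evident; `eval_carlitzPsi` identifies
it with the evaluation of the product `carlitzPsi F s`. -/
noncomputable def carlitzMap : ℕ → F[X] →ₗ[F] F[X]
  | 0 => LinearMap.id
  | s + 1 => (FiniteField.frobeniusAlgHom F F[X]).toLinearMap ∘ₗ carlitzMap s -
      LinearMap.mulLeft F (carlitzF F s ^ (Fintype.card F - 1)) ∘ₗ carlitzMap s

theorem carlitzMap_zero (a : F[X]) : carlitzMap F 0 a = a := rfl

theorem carlitzMap_succ (s : ℕ) (a : F[X]) :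
    carlitzMap F (s + 1) a = carlitzMap F s a ^ Fintype.card F -
      carlitzF F s ^ (Fintype.card F - 1) * carlitzMap F s a := rfl

theorem carlitzF_succ_pow_mul (s : ℕ) :
    carlitzF F (s + 1) ^ (Fintype.card F - 1) * (X ^ Fintype.card F ^ (s + 1) - X) =
      (X ^ Fintype.card F ^ (s + 1) - X) ^ Fintype.card F *
        (carlitzF F s ^ (Fintype.card F - 1)) ^ Fintype.card F := by
  rw [carlitzF_succ, mul_pow, mul_right_comm, ← pow_succ, Nat.sub_add_cancel Fintype.card_pos,
    pow_right_comm]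

theorem carlitzMap_succ_X_mul (s : ℕ) (a : F[X]) :
    carlitzMap F (s + 1) (X * a) = X * carlitzMap F (s + 1) a +
      (X ^ Fintype.card F ^ (s + 1) - X) * carlitzMap F s a ^ Fintype.card F := by
  have frob_add : ∀ x y : F[X],
      (x + y) ^ Fintype.card F = x ^ Fintype.card F + y ^ Fintype.card F :=
    map_add (FiniteField.frobeniusAlgHom F F[X])
  have frob_sub : ∀ x y : F[X],
      (x - y) ^ Fintype.card F = x ^ Fintype.card F - y ^ Fintype.card F :=
    map_sub (FiniteField.frobeniusAlgHom F F[X])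
  induction s with
  | zero =>
    simp only [carlitzMap_succ, carlitzMap_zero, carlitzF_zero, one_pow, zero_add, pow_one]
    ring
  | succ s ih =>
    have hbracket : (X ^ Fintype.card F ^ (s + 2) - X : F[X]) =
        (X ^ Fintype.card F ^ (s + 1) - X) ^ Fintype.card F + X ^ Fintype.card F - X := by
      rw [frob_sub, ← pow_mul, ← pow_succ]
      ring
    have hpow : carlitzMap F (s + 1) a ^ Fintype.card F =
        (carlitzMap F s a ^ Fintype.card F) ^ Fintype.card F -
          (carlitzF F s ^ (Fintype.card F - 1)) ^ Fintype.card F *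
            carlitzMap F s a ^ Fintype.card F := by
      rw [carlitzMap_succ, frob_sub, mul_pow]
    rw [carlitzMap_succ F (s + 1), carlitzMap_succ F (s + 1), ih, hbracket, frob_add, mul_pow,
      mul_pow]
    linear_combination (-carlitzMap F s a ^ Fintype.card F) * carlitzF_succ_pow_mul F s -
      (X ^ Fintype.card F ^ (s + 1) - X) ^ Fintype.card F * hpow

variable {F}

theorem carlitzMap_succ_eq_zero {s : ℕ} {a : F[X]} {c : F}
    (h : carlitzMap F s a = c • carlitzF F s) : carlitzMap F (s + 1) a = 0 := by
  rw [carlitzMap_succ, h, _root_.smul_pow, FiniteField.pow_card, mul_smul_comm, ← pow_succ,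
    Nat.sub_add_cancel Fintype.card_pos, sub_self]

theorem carlitzMap_of_natDegree_le {s : ℕ} {a : F[X]} (ha : a.natDegree ≤ s) :
    carlitzMap F s a = a.coeff s • carlitzF F s := by
  induction s generalizing a with
  | zero =>
    rw [carlitzMap_zero, carlitzF_zero, smul_eq_C_mul, mul_one]
    exact eq_C_of_natDegree_le_zero ha
  | succ s ih =>
    have hdivX : carlitzMap F s a.divX = a.coeff (s + 1) • carlitzF F s := by
      rw [ih (by rw [natDegree_divX_eq_natDegree_tsub_one]; lia), coeff_divX]
    have hC : carlitzMap F (s + 1) (C (a.coeff 0)) = 0 := carlitzMap_succ_eq_zero (ih (by simp))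
    conv_lhs => rw [← X_mul_divX_add a]
    rw [map_add, hC, add_zero, carlitzMap_succ_X_mul, carlitzMap_succ_eq_zero hdivX, hdivX,
      mul_zero, zero_add, _root_.smul_pow, FiniteField.pow_card, mul_smul_comm, carlitzF_succ]

theorem carlitzMap_of_degree_lt {s : ℕ} {a : F[X]} (ha : a.degree < s) : carlitzMap F s a = 0 := by
  rw [carlitzMap_of_natDegree_le (natDegree_le_of_degree_le ha.le), coeff_eq_zero_of_degree_lt ha,
    zero_smul]

theorem carlitzMap_of_monic {a : F[X]} (ha : a.Monic) :
    carlitzMap F a.natDegree a = carlitzF F a.natDegree := by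
  rw [carlitzMap_of_natDegree_le le_rfl, ha.coeff_natDegree, one_smul]

theorem carlitzF_dvd_carlitzMap (s : ℕ) (a : F[X]) : carlitzF F s ∣ carlitzMap F s a := by
  induction s generalizing a with
  | zero => simp [carlitzF_zero]
  | succ s ih =>
    induction a using Polynomial.recOnHorner with
    | M0 => simp
    | MC a c _ _ iha =>
      have hC : carlitzMap F (s + 1) (C c) = 0 :=
        carlitzMap_of_degree_lt (degree_C_le.trans_lt (by exact_mod_cast s.succ_pos))
      rwa [map_add, hC, add_zero]
    | MX a _ iha =>
      rw [mul_comm, carlitzMap_succ_X_mul]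
      refine dvd_add (iha.mul_left X) ?_
      rw [carlitzF_succ]
      exact mul_dvd_mul_left _ (pow_dvd_pow_of_dvd (ih a) _)

end CarlitzMap

section CarlitzPsi

theorem monic_pow_sub_C_mul {R : Type*} [CommRing R] {p : R[X]} (hp : p.Monic)
    (hp0 : 0 < p.natDegree) {n : ℕ} (hn : 1 < n) (c : R) :
    (p ^ n - C c * p).Monic ∧ (p ^ n - C c * p).natDegree = n * p.natDegree := by
  have hlt : (C c * p).natDegree < (p ^ n).natDegree := by
    rw [hp.natDegree_pow]
    exact (natDegree_C_mul_le c p).trans_lt (lt_mul_of_one_lt_left hp0 hn)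
  exact ⟨(hp.pow n).sub_of_left (degree_lt_degree hlt), by
    rw [natDegree_sub_eq_left_of_natDegree_lt hlt, hp.natDegree_pow]⟩

theorem eq_nodal_of_monic {R ι : Type*} [CommRing R] [IsDomain R] {p : R[X]} (hp : p.Monic)
    {s : Finset ι} {v : ι → R} (hv : Set.InjOn v s) (hdeg : p.natDegree = s.card)
    (heval : ∀ i ∈ s, p.eval (v i) = 0) : p = Lagrange.nodal s v := by
  have hdeg' : p.degree = s.card := by rw [degree_eq_natDegree hp.ne_zero, hdeg]
  refine eq_of_degree_le_of_eval_index_eq s hv hdeg'.le (hdeg'.trans Lagrange.degree_nodal.symm)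
    (hp.leadingCoeff.trans Lagrange.nodal_monic.leadingCoeff.symm) fun i hi => ?_
  rw [heval i hi, Lagrange.eval_nodal_at_node hi]

variable (F : Type*) [Field F] [Fintype F]

theorem card_setOf_degree_lt (m : ℕ) :
    (finite_setOf_degree_lt F m).toFinset.card = Fintype.card F ^ m := by
  have hset : {f : F[X] | f.degree < m} = (degreeLT F m : Set F[X]) :=
    Set.ext fun _ => mem_degreeLT.symm
  rw [← Set.ncard_eq_toFinset_card _ (finite_setOf_degree_lt F m), hset, ← Nat.card_coe_set_eq]
  exact (Nat.card_congr (degreeLTEquiv F m).toEquiv).trans (by simp)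

theorem carlitzPsi_eq_nodal (m : ℕ) :
    carlitzPsi F m =
      Lagrange.nodal (finite_setOf_degree_lt F m).toFinset (algebraMap F[X] (RatFunc F)) :=
  (Lagrange.nodal_eq _ _).symm

theorem carlitzPsi_ne_zero (m : ℕ) : carlitzPsi F m ≠ 0 := by
  rw [carlitzPsi_eq_nodal]
  exact Lagrange.nodal_ne_zero

theorem natDegree_carlitzPsi (m : ℕ) : (carlitzPsi F m).natDegree = Fintype.card F ^ m := by
  rw [carlitzPsi_eq_nodal, Lagrange.natDegree_nodal, card_setOf_degree_lt]

theorem exists_monic_eval_eq_carlitzMap (K : Type*) [CommRing K] [Nontrivial K] [Algebra F[X] K]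
    (s : ℕ) :
    ∃ p : K[X], p.Monic ∧ p.natDegree = Fintype.card F ^ s ∧
      ∀ a : F[X], p.eval (algebraMap F[X] K a) = algebraMap F[X] K (carlitzMap F s a) := by
  induction s with
  | zero => exact ⟨X, monic_X, by simp, fun a => by simp [carlitzMap_zero]⟩
  | succ s ih =>
    obtain ⟨p, hp, hdeg, heval⟩ := ih
    obtain ⟨hmonic, hdeg'⟩ := monic_pow_sub_C_mul hp (hdeg ▸ pow_pos Fintype.card_pos s)
      (Fintype.one_lt_card (α := F)) (algebraMap F[X] K (carlitzF F s ^ (Fintype.card F - 1)))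
    refine ⟨_, hmonic, by rw [hdeg', hdeg, pow_succ'], fun a => ?_⟩
    rw [eval_sub, eval_pow, eval_mul, eval_C, heval, carlitzMap_succ, map_sub, map_mul,
      map_pow _ (carlitzMap F s a)]

theorem eval_carlitzPsi (s : ℕ) (a : F[X]) :
    (carlitzPsi F s).eval (algebraMap F[X] (RatFunc F) a) =
      algebraMap F[X] (RatFunc F) (carlitzMap F s a) := by
  obtain ⟨p, hp, hdeg, heval⟩ := exists_monic_eval_eq_carlitzMap F (RatFunc F) s
  have hroots : ∀ f ∈ (finite_setOf_degree_lt F s).toFinset,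
      p.eval (algebraMap F[X] (RatFunc F) f) = 0 := fun f hf => by
    rw [heval, carlitzMap_of_degree_lt (by simpa using hf), map_zero]
  rw [← heval, carlitzPsi_eq_nodal, eq_nodal_of_monic hp
    (FaithfulSMul.algebraMap_injective F[X] (RatFunc F)).injOn
    (hdeg.trans (card_setOf_degree_lt F s).symm) hroots]

end CarlitzPsi

section Digits

theorem sum_range_div_pow_mod_mul_pow (b k n : ℕ) :
    ∑ i ∈ Finset.range n, k / b ^ i % b * b ^ i = k % b ^ n := by
  induction n with
  | zero => simp [Nat.mod_one]
  | succ n ih => rw [Finset.sum_range_succ, ih, Nat.mod_pow_succ, mul_comm (b ^ n)]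

theorem div_pow_log_mod_ne_zero {b k : ℕ} (hb : 1 < b) (hk : k ≠ 0) :
    k / b ^ Nat.log b k % b ≠ 0 := by
  have hlt : k / b ^ Nat.log b k < b :=
    Nat.div_lt_of_lt_mul (by rw [← pow_succ]; exact Nat.lt_pow_succ_log_self hb k)
  rw [Nat.mod_eq_of_lt hlt]
  exact (Nat.div_pos (Nat.pow_log_le_self b hk) (pow_pos (by lia) _)).ne'

end Digits

section CarlitzBinomial

variable (F : Type*) [Field F] [Fintype F]

theorem algebraMap_carlitzF_ne_zero (s : ℕ) : algebraMap F[X] (RatFunc F) (carlitzF F s) ≠ 0 := by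
  simpa using carlitzF_ne_zero F s

theorem carlitzBinomial_eq_prod_psi {k n : ℕ} (hk : k < Fintype.card F ^ n) :
    carlitzBinomial F k = ∏ i ∈ Finset.range n,
      (C (algebraMap F[X] (RatFunc F) (carlitzF F i))⁻¹ * carlitzPsi F i) ^
        (k / Fintype.card F ^ i % Fintype.card F) := by
  have hq : 1 < Fintype.card F := Fintype.one_lt_card
  have hlen : (Nat.digits (Fintype.card F) k).length ≤ n := (Nat.digits_length_le_iff hq k).mpr hk
  simp only [← Nat.getD_digits k _ hq]
  rw [← Finset.prod_subset (Finset.range_subset_range.mpr hlen)]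
  · simp only [carlitzBinomial, carlitzg, carlitzG, mul_pow, Finset.prod_mul_distrib, map_prod,
      map_pow, ← Finset.prod_inv_distrib, ← inv_pow]
  · intro i _ hi
    rw [List.getD_eq_default _ _ (by simpa using hi), pow_zero]

theorem carlitzBinomial_card_pow (s : ℕ) :
    carlitzBinomial F (Fintype.card F ^ s) =
      C (algebraMap F[X] (RatFunc F) (carlitzF F s))⁻¹ * carlitzPsi F s := by
  have hq : 1 < Fintype.card F := Fintype.one_lt_card
  rw [carlitzBinomial_eq_prod_psi F (Nat.pow_lt_pow_right hq s.lt_succ_self),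
    Finset.prod_range_succ, Finset.prod_eq_one, one_mul, Nat.div_self (pow_pos (by lia) s),
    Nat.mod_eq_of_lt hq, pow_one]
  intro i hi
  have hi : i < s := Finset.mem_range.mp hi
  rw [Nat.pow_div hi.le (by lia), Nat.mod_eq_zero_of_dvd (dvd_pow_self _ (by lia)), pow_zero]

theorem carlitzBinomial_eq_prod {k n : ℕ} (hk : k < Fintype.card F ^ n) :
    carlitzBinomial F k = ∏ i ∈ Finset.range n,
      carlitzBinomial F (Fintype.card F ^ i) ^ (k / Fintype.card F ^ i % Fintype.card F) := by
  simp only [carlitzBinomial_card_pow, carlitzBinomial_eq_prod_psi F hk]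

theorem natDegree_carlitzBinomial (k : ℕ) : (carlitzBinomial F k).natDegree = k := by
  have hF : ∀ i, C (algebraMap F[X] (RatFunc F) (carlitzF F i))⁻¹ ≠ 0 := fun i =>
    C_ne_zero.mpr (inv_ne_zero (algebraMap_carlitzF_ne_zero F i))
  have hk : k < Fintype.card F ^ k := Nat.lt_pow_self Fintype.one_lt_card
  rw [carlitzBinomial_eq_prod_psi F hk, natDegree_prod _ _ fun i _ =>
    pow_ne_zero _ (mul_ne_zero (hF i) (carlitzPsi_ne_zero F i))]
  simp only [natDegree_pow, natDegree_C_mul (inv_ne_zero (algebraMap_carlitzF_ne_zero F _)),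
    natDegree_carlitzPsi]
  rw [sum_range_div_pow_mod_mul_pow, Nat.mod_eq_of_lt hk]

theorem eval_carlitzBinomial_card_pow (s : ℕ) (a : F[X]) :
    (carlitzBinomial F (Fintype.card F ^ s)).eval (algebraMap F[X] (RatFunc F) a) =
      (algebraMap F[X] (RatFunc F) (carlitzF F s))⁻¹ *
        algebraMap F[X] (RatFunc F) (carlitzMap F s a) := by
  rw [carlitzBinomial_card_pow, eval_mul, eval_C, eval_carlitzPsi]

theorem carlitzBinomial_card_pow_mem (s : ℕ) :
    carlitzBinomial F (Fintype.card F ^ s) ∈ integerValuedPolynomials F[X] (RatFunc F) := by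
  intro a
  obtain ⟨b, hb⟩ := carlitzF_dvd_carlitzMap s a
  refine ⟨b, ?_⟩
  rw [eval_carlitzBinomial_card_pow, hb, map_mul,
    inv_mul_cancel_left₀ (algebraMap_carlitzF_ne_zero F s)]

theorem carlitzBinomial_mem (k : ℕ) :
    carlitzBinomial F k ∈ integerValuedPolynomials F[X] (RatFunc F) := by
  rw [carlitzBinomial_eq_prod F (Nat.lt_pow_self Fintype.one_lt_card)]
  exact prod_mem fun i _ => pow_mem (carlitzBinomial_card_pow_mem F i) _

/-- The Carlitz binomial polynomial `β_k` as an element of `Int(𝔽_q[t])`, the ring in which its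
factorizations are studied. -/
noncomputable def carlitzBinomialInt (k : ℕ) : integerValuedPolynomials F[X] (RatFunc F) :=
  ⟨carlitzBinomial F k, carlitzBinomial_mem F k⟩

end CarlitzBinomial

section Irreducibility

theorem exists_monic_irreducible_natDegree_eq (F : Type*) [Field F] [Finite F] {n : ℕ}
    (hn : n ≠ 0) : ∃ P : F[X], P.Monic ∧ Irreducible P ∧ P.natDegree = n := by
  obtain ⟨p, _⟩ := CharP.exists F
  have : Fact p.Prime := ⟨CharP.char_is_prime F p⟩
  have : NeZero n := ⟨hn⟩
  obtain ⟨α, hα⟩ := Field.exists_primitive_element F (FiniteField.Extension F p n)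
  have hint : IsIntegral F α := IsIntegral.of_finite F α
  refine ⟨minpoly F α, minpoly.monic hint, minpoly.irreducible hint, ?_⟩
  rw [(Field.primitive_element_iff_minpoly_natDegree_eq F α).mp hα,
    FiniteField.finrank_extension]

variable {F : Type*} [Field F] [Fintype F]

theorem evalHom_carlitzBinomialInt_of_monic {a : F[X]} (ha : a.Monic) :
    integerValuedPolynomials.evalHom a
      (carlitzBinomialInt F (Fintype.card F ^ a.natDegree)) = 1 := by
  apply FaithfulSMul.algebraMap_injective F[X] (RatFunc F)
  rw [integerValuedPolynomials.algebraMap_evalHom, carlitzBinomialInt,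
    eval_carlitzBinomial_card_pow, carlitzMap_of_monic ha,
    inv_mul_cancel₀ (algebraMap_carlitzF_ne_zero F _), map_one]

theorem isSeparatingPrime_carlitzBinomialInt {P : F[X]} (hP : P.Monic) (hirr : Irreducible P) :
    integerValuedPolynomials.IsSeparatingPrime
      (carlitzBinomialInt F (Fintype.card F ^ P.natDegree))
      (finite_setOf_degree_lt F P.natDegree).toFinset P := by
  have hdeg : P.degree = P.natDegree := degree_eq_natDegree hP.ne_zero
  have hlt : ∀ r ∈ (finite_setOf_degree_lt F P.natDegree).toFinset, r.degree < P.degree :=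
    fun r hr => by rwa [Set.Finite.mem_toFinset, Set.mem_ofPred_eq, ← hdeg] at hr
  refine ⟨hirr.prime, fun r hr r' hr' hdvd => ?_, fun r hr => ?_⟩
  · exact sub_eq_zero.mp <| eq_zero_of_dvd_of_degree_lt hdvd <|
      (degree_sub_le r r').trans_lt (max_lt (hlt r hr) (hlt r' hr'))
  · rw [← natDegree_add_eq_left_of_degree_lt (hlt r hr),
      evalHom_carlitzBinomialInt_of_monic (hP.add_of_left (hlt r hr))]
    exact isUnit_one

theorem absolutelyIrreducible_carlitzBinomialInt (s : ℕ) :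
    AbsolutelyIrreducible (carlitzBinomialInt F (Fintype.card F ^ s)) := by
  have hunit : IsUnit (integerValuedPolynomials.evalHom (X ^ s)
      (carlitzBinomialInt F (Fintype.card F ^ s))) := by
    have := evalHom_carlitzBinomialInt_of_monic (monic_X_pow (R := F) s)
    rw [natDegree_X_pow] at this
    exact this ▸ isUnit_one
  refine integerValuedPolynomials.absolutelyIrreducible_of_isSeparatingPrime
    (S := (finite_setOf_degree_lt F s).toFinset) ⟨0, by simp⟩ (carlitzBinomial_card_pow F s)
    hunit fun hS => ?_
  have hs : s ≠ 0 := by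
    rintro rfl
    rw [← Finset.one_lt_card_iff_nontrivial, card_setOf_degree_lt, pow_zero] at hS
    exact hS.false
  obtain ⟨P, hP, hirr, rfl⟩ := exists_monic_irreducible_natDegree_eq F hs
  exact ⟨P, isSeparatingPrime_carlitzBinomialInt hP hirr⟩

theorem carlitzBinomialInt_card_pow_log_dvd {k : ℕ} (hk : k ≠ 0) :
    carlitzBinomialInt F (Fintype.card F ^ Nat.log (Fintype.card F) k) ∣
      carlitzBinomialInt F k := by
  have hq : 1 < Fintype.card F := Fintype.one_lt_card
  have hprod : carlitzBinomialInt F k = ∏ i ∈ Finset.range (Nat.log (Fintype.card F) k + 1),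
      carlitzBinomialInt F (Fintype.card F ^ i) ^
        (k / Fintype.card F ^ i % Fintype.card F) := by
    refine Subtype.ext ((carlitzBinomial_eq_prod F (Nat.lt_pow_succ_log_self hq k)).trans ?_)
    simp [carlitzBinomialInt]
  rw [hprod, Finset.prod_range_succ]
  exact (dvd_pow_self _ (div_pow_log_mod_ne_zero hq hk)).mul_left _

theorem irreducible_carlitzBinomialInt_iff {k : ℕ} (hk : k ≠ 0) :
    Irreducible (carlitzBinomialInt F k) ↔ ∃ s : ℕ, k = Fintype.card F ^ s := by
  refine ⟨fun hirr => ⟨Nat.log (Fintype.card F) k, ?_⟩, ?_⟩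
  · have hassoc := (absolutelyIrreducible_carlitzBinomialInt _).1.associated_of_dvd hirr
      (carlitzBinomialInt_card_pow_log_dvd hk)
    simpa only [carlitzBinomialInt, natDegree_carlitzBinomial] using
      (integerValuedPolynomials.natDegree_eq_of_associated hassoc).symm
  · rintro ⟨s, rfl⟩
    exact (absolutelyIrreducible_carlitzBinomialInt s).1

end Irreducibility

theorem theorem1 (F : Type*) [Field F] [Fintype F] (q : ℕ) (hq : Fintype.card F = q) :
    ∃ hβ : ∀ k : ℕ, carlitzBinomial F k ∈ integerValuedPolynomials F[X] (RatFunc F),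
      (∀ k : ℕ, 0 < k →
        (Irreducible (⟨carlitzBinomial F k, hβ k⟩ : integerValuedPolynomials F[X] (RatFunc F)) ↔
          ∃ s : ℕ, k = q ^ s) ∧
        ∃ (s : ℕ) (α : ℕ → ℕ), (∀ i ≤ s, α i < q) ∧ α s ≠ 0 ∧
          k = ∑ i ∈ Finset.range (s + 1), α i * q ^ i ∧
          carlitzBinomial F k =
            ∏ i ∈ Finset.range (s + 1), carlitzBinomial F (q ^ i) ^ α i) ∧
      ∀ s : ℕ, AbsolutelyIrreducible
        (⟨carlitzBinomial F (q ^ s), hβ (q ^ s)⟩ :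
          integerValuedPolynomials F[X] (RatFunc F)) := by
  subst hq
  have hq : 1 < Fintype.card F := Fintype.one_lt_card
  refine ⟨carlitzBinomial_mem F, fun k hk => ⟨irreducible_carlitzBinomialInt_iff hk.ne', ?_⟩,
    absolutelyIrreducible_carlitzBinomialInt⟩
  have hlog : k < Fintype.card F ^ (Nat.log (Fintype.card F) k + 1) :=
    Nat.lt_pow_succ_log_self hq k
  refine ⟨Nat.log (Fintype.card F) k, fun i => k / Fintype.card F ^ i % Fintype.card F,
    fun i _ => Nat.mod_lt _ (by lia), div_pow_log_mod_ne_zero hq hk.ne', ?_,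
    carlitzBinomial_eq_prod F hlog⟩
  rw [sum_range_div_pow_mod_mul_pow, Nat.mod_eq_of_lt hlog]
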